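/- Let $K$ be a field with a non-trivial valuation $\operatorname{ord}:K\to\mathbb{R}\cup\{\infty\}$, extended to an algebraic closure $\bar K$. For an ideal $I\lhd K[x_1,\dots,x_n]$ the tropical variety $\mathcal{T}(I)$ is the topological closure in $\mathbb{R}^n$ of the set of all $(\operatorname{ord} z_1,\dots,\operatorname{ord} z_n)$ with $z\in(\bar K\setminus\{0\})^n$ a zero of $I$. Let $m\ge 0$, $l\ge 0$ and $n=m+1+l$. Let $\pi:\mathbb{R}^n\to\mathbb{R}^{m+1}$, $x\mapsto Ax$, where $A$ is a rational matrix with linearly independent rows, and let $u^{(1)},\dots,u^{(l)}\in\mathbb{Q}^n$ be a basis of the orthogonal complement (in $\mathbb{Q}^n$) of the span of the rows of $A$. Set $R=K[x_1,\dots,x_n,\lambda_1^{\pm1},\dots,\lambda_l^{\pm1}]$. For an ideal $I\lhd K[x_1,\dots,x_n]$ let $J\lhd R$ be the ideal $$J=\Big\langle g\in R \;:\; g=f\Big(x_1\prod_{j=1}^l\lambda_j^{u^{(j)}_1},\dots,x_n\prod_{j=1}^l\lambda_j^{u^{(j)}_n}\Big)\text{ for some } f\in I\Big\rangle ,$$ where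 the right-hand sides are computed in the ring of polynomials in $x_1,\dots,x_n$ and rational powers of $\lambda_1,\dots,\lambda_l$, which contains $R$. The projection $\pi$ (with the chosen basis) is called algebraically regular for $I$ if for each $i\in\{1,\dots,l\}$ the elimination ideal $J\cap K[x_1,\dots,x_n,\lambda_1^{\pm1},\dots,\lambda_i^{\pm1}]$ of the ring $K[x_1,\dots,x_n,\lambda_1^{\pm1},\dots,\lambda_i^{\pm1}]$ has a finite generating set $\mathcal{F}_i$ such that in every $f\in\mathcal{F}_i$ the coefficient of each power of $\lambda_i$ is zero or a monomial, i.e. a scalar times a product of powers of $x_1,\dots,x_n,\lambda_1,\dots,\lambda_{i-1}$. **Theorem.** Let $I\lhd K[x_1,\dots,x_n]$ be a prime ideal and let $\pi$ be algebraically regular for $I$. Then $\pi^{-1}(\pi(\mathcal{T}(I)))$ is a tropical variety, namely $$\pi^{-1}(\pi(\mathcal{T}(I)))=\mathcal{T}\big(J\cap K[x_1,\dots,x_n]\big).$$ -/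

import Mathlib

namespace TropProj

noncomputable section

/-- The Laurent polynomial ring `K[x₁,…,xₙ, λ₁^{±1},…,λₗ^{±1}]`.  The exponent `(α, γ)` stands for
the monomial `x^α λ^γ`. -/
abbrev LRing (K : Type*) [Field K] (n l : ℕ) : Type _ :=
  AddMonoidAlgebra K ((Fin n →₀ ℕ) × (Fin l → ℤ))

/-- The ring of polynomials in `x₁,…,xₙ` and arbitrary rational powers of `λ₁,…,λₗ`. -/
abbrev QRing (K : Type*) [Field K] (n l : ℕ) : Type _ :=
  AddMonoidAlgebra K ((Fin n →₀ ℕ) × (Fin l → ℚ))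

/-- The inclusion `x^α λ^γ ↦ x^α λ^γ` of the Laurent polynomial ring into `QRing`. -/
def toQ (K : Type*) [Field K] (n l : ℕ) : LRing K n l →+* QRing K n l :=
  AddMonoidAlgebra.mapDomainRingHom K
    ((AddMonoidHom.id (Fin n →₀ ℕ)).prodMap
      ((Int.castAddHom ℚ).compLeft (Fin l)))

/-- The substitution `f ↦ f(x₁ ∏ⱼ λⱼ^{u₁⁽ʲ⁾}, …, xₙ ∏ⱼ λⱼ^{uₙ⁽ʲ⁾})`, where `u j i = uᵢ⁽ʲ⁾`. -/
def twist {K : Type*} [Field K] {n l : ℕ} (u : Fin l → Fin n → ℚ) :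
    MvPolynomial (Fin n) K →ₐ[K] QRing K n l :=
  MvPolynomial.aeval fun i =>
    AddMonoidAlgebra.single (Finsupp.single i 1, fun j => u j i) (1 : K)

/-- The inclusion `K[x₁,…,xₙ] → K[x₁,…,xₙ, λ₁^{±1},…,λₗ^{±1}]`. -/
def incl (K : Type*) [Field K] (n l : ℕ) : MvPolynomial (Fin n) K →ₐ[K] LRing K n l :=
  MvPolynomial.aeval fun i => AddMonoidAlgebra.single (Finsupp.single i 1, 0) (1 : K)

/-- The ideal `J` of the Laurent polynomial ring generated by all its elements `g` of the form
`g = f(x₁ ∏ⱼ λⱼ^{u₁⁽ʲ⁾}, …, xₙ ∏ⱼ λⱼ^{uₙ⁽ʲ⁾})` with `f ∈ I`. -/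
def twistIdeal {K : Type*} [Field K] {n l : ℕ} (u : Fin l → Fin n → ℚ)
    (I : Ideal (MvPolynomial (Fin n) K)) : Ideal (LRing K n l) :=
  Ideal.span {g | ∃ f ∈ I, toQ K n l g = twist u f}

/-- The elimination ideal `J ∩ K[x₁,…,xₙ]`. -/
def elimIdeal {K : Type*} [Field K] {n l : ℕ} (J : Ideal (LRing K n l)) :
    Ideal (MvPolynomial (Fin n) K) :=
  J.comap (incl K n l)

/-- The subring `K[x₁,…,xₙ, λ₁^{±1},…,λₖ^{±1}]` of the Laurent polynomial ring: the elements in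
which only the first `k` of the variables `λ₁,…,λₗ` occur. -/
def partialRing (K : Type*) [Field K] (n l k : ℕ) : Subalgebra K (LRing K n l) where
  carrier := {g | ∀ p ∈ g.coeff.support, ∀ j : Fin l, k ≤ (j : ℕ) → p.2 j = 0}
  mul_mem' := by
    classical
    intro a b ha hb p hp j hj
    obtain ⟨q, hq, r, hr, rfl⟩ := Finset.mem_add.1 (AddMonoidAlgebra.support_coeff_mul_subset a b hp)
    simp [ha q hq j hj, hb r hr j hj]
  add_mem' := by
    classical
    intro a b ha hb p hp j hj
    rcases Finset.mem_union.1 (Finsupp.support_add hp) with h | h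
    · exact ha p h j hj
    · exact hb p h j hj
  algebraMap_mem' := by
    classical
    intro c p hp j _
    have h : p = 0 := by
      have := Finsupp.support_single_subset hp
      simpa using this
    simp [h]

/-- Algebraic regularity: for every `i`, the elimination ideal
`J ∩ K[x, λ₁^{±1},…,λᵢ^{±1}]` is generated, as an ideal of `K[x, λ₁^{±1},…,λᵢ^{±1}]`, by a finite
set `F` such that in every `f ∈ F` the coefficient of each power of `λᵢ` is a monomial in `x` and
`λ₁,…,λᵢ₋₁` (a scalar times a product of powers, or zero); that is, no two distinct terms of `f`
have the same exponent of `λᵢ`. The variable called `λᵢ` here has index `i - 1` in `Fin l`. -/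
def AlgRegular {K : Type*} [Field K] {n l : ℕ} (u : Fin l → Fin n → ℚ)
    (I : Ideal (MvPolynomial (Fin n) K)) : Prop :=
  ∀ i : Fin l, ∃ F : Finset (LRing K n l),
    (Submodule.span (partialRing K n l (i + 1)) (F : Set (LRing K n l)) : Set (LRing K n l)) =
      (twistIdeal u I : Set (LRing K n l)) ∩ (partialRing K n l (i + 1) : Set (LRing K n l)) ∧
    ∀ f ∈ F, ∀ p ∈ f.coeff.support, ∀ q ∈ f.coeff.support, p.2 i = q.2 i → p = q

/-- The tropical variety of `I`: the closure in `ℝⁿ` of the set of all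
`(ord z₁, …, ord zₙ)` with `z` a zero of `I` in `(L ∖ {0})ⁿ`, where `L` is the algebraic closure.
(That `ord zᵢ` is a real number, and not `⊤`, says that `zᵢ ≠ 0`.) -/
def tropVariety {K : Type*} [Field K] {L : Type*} [Field L] [Algebra K L]
    (ord : AddValuation L (WithTop ℝ)) {n : ℕ} (I : Ideal (MvPolynomial (Fin n) K)) :
    Set (Fin n → ℝ) :=
  closure {w | ∃ z : Fin n → L, (∀ f ∈ I, MvPolynomial.aeval z f = 0) ∧
    ∀ i, ord (z i) = ((w i : ℝ) : WithTop ℝ)}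

/-- The rational projection `ℝⁿ → ℝᵏ`, `x ↦ A x`. -/
def proj {k n : ℕ} (A : Matrix (Fin k) (Fin n) ℚ) (x : Fin n → ℝ) : Fin k → ℝ :=
  (A.map (fun q : ℚ => (q : ℝ))).mulVec x

end

end TropProj

/-! Write π for the projection and T for tropical varieties. The kernel of π is the real span of the
vectors `u j`, so π⁻¹(π(T(I))) consists of the translates of T(I) along that span.

Such translates lie in the tropical variety of the elimination ideal. Choose a homomorphism χ : ℚ →
Lˣ whose value at 1 has nonzero valuation. If z is a zero of I, put λⱼ = χ(qⱼ) and divide zᵢ by χ(∑ⱼ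
qⱼ uᵢ⁽ʲ⁾). The twist undoes this division, so the new point is a zero of J and its x-part a zero of
the elimination ideal. This realises a dense set of translations, and taking closures gives the rest
(`add_combination_mem_tropVariety`).

Conversely, let x be a torus zero of the elimination ideal. By regularity the coefficients of powers
of λᵢ are monomials, which do not vanish on the torus. The nonvanishing leading coefficient lets x
extend to λᵢ by a resultant argument, and the nonvanishing lowest one forces λᵢ ≠ 0
(`exists_update_of_monomial_coeffs`). Two terms of a vanishing sum must have equal valuation, which
bounds ord λᵢ in terms of the earlier coordinates (`exists_bound_realOrd`). With N a common
denominator of u, the point x^N λ^{Nu} then lifts along the integral map xᵢ ↦ xᵢ^N to a zero z of I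
(`exists_zero_of_zero_twistIdeal`), and ord z differs from ord x by a combination of the `u j`. The
bounds are uniform, so compactness carries the conclusion to the closure
(`proj_mem_image_of_mem_tropVariety`). -/

/-! ### General lemmas on zeros, divisibility, valuations and rational kernels -/

open Polynomial in
/-- Elimination in one variable over an algebraically closed field. -/
theorem Ideal.exists_eval₂_eq_zero_of_leadingCoeff {A L : Type*} [CommRing A] [Field L]
    [IsAlgClosed L] (φ : A →+* L) (a : Ideal A[X]) (ha : ∀ c, C c ∈ a → φ c = 0)
    {f : A[X]} (hf : f ∈ a) (hlc : φ f.leadingCoeff ≠ 0) :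
    ∃ μ, ∀ g ∈ a, g.eval₂ φ μ = 0 := by
  classical
  have hmap : (f.map φ).natDegree = f.natDegree :=
    Polynomial.natDegree_map_of_leadingCoeff_ne_zero φ hlc
  by_contra! hcon
  -- Prime avoidance: if every g vanished at some root of f, the ideal would be covered by finitely
  -- many kernels of evaluations, hence lie in one of them.
  have hg : ∃ g ∈ a, ∀ μ ∈ (f.map φ).roots, g.eval₂ φ μ ≠ 0 := by
    by_contra! hno
    have hsub : (a : Set A[X]) ⊆ ⋃ μ ∈ (((f.map φ).roots.toFinset : Finset L) : Set L),
        (RingHom.ker (eval₂RingHom φ μ) : Set A[X]) := by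
      intro g hg
      obtain ⟨μ, hμ, h⟩ := hno g hg
      simp only [Set.mem_iUnion]
      exact ⟨μ, by simpa using hμ, by simpa [RingHom.mem_ker] using h⟩
    rw [Ideal.subset_union_prime 0 0 (fun i _ _ _ => RingHom.ker_isPrime _)] at hsub
    obtain ⟨μ, -, hμ⟩ := hsub
    obtain ⟨g, hg, h⟩ := hcon μ
    exact h (by simpa [RingHom.mem_ker] using hμ hg)
  obtain ⟨g, hg, hne⟩ := hg
  have hdeg : f.natDegree ≠ 0 := by
    intro h0
    apply hlc
    apply ha
    rw [Polynomial.leadingCoeff, h0, ← Polynomial.eq_C_of_natDegree_eq_zero h0]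
    exact hf
  -- The resultant of f and g is a constant in the ideal, so φ kills it. It is taken in formal
  -- degrees, so it commutes with φ even if the degree of g drops, and becomes a power of the
  -- leading coefficient of f times the product of g over the roots.
  obtain ⟨p, q, -, -, hpq⟩ := Polynomial.exists_mul_add_mul_eq_C_resultant f g
    le_rfl le_rfl (Or.inl hdeg)
  have h0 : φ (f.resultant g f.natDegree g.natDegree) = 0 :=
    ha _ (hpq ▸ a.add_mem (a.mul_mem_right _ hf) (a.mul_mem_right _ hg))
  rw [← Polynomial.resultant_map_map, ← hmap, Polynomial.resultant_eq_prod_eval _ _ _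
    Polynomial.natDegree_map_le (IsAlgClosed.splits _)] at h0
  refine mul_ne_zero (pow_ne_zero _ ?_) ?_ h0
  · rwa [Polynomial.leadingCoeff_map_of_leadingCoeff_ne_zero φ hlc]
  · rw [Ne, Multiset.prod_eq_zero_iff, Multiset.mem_map]
    rintro ⟨μ, hμ, h⟩
    exact hne μ hμ (by rwa [Polynomial.eval_map] at h)

/-- A homomorphism to an algebraically closed field extends along integral homomorphisms, and the
extension can be made to vanish on a given compatible ideal. -/
theorem RingHom.IsIntegral.exists_extension {R S L : Type*} [CommRing R] [CommRing S] [Field L]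
    [IsAlgClosed L] {ψ : R →+* S} (hψ : ψ.IsIntegral) (I : Ideal S) (φ : R →+* L)
    (h : ∀ r, ψ r ∈ I → φ r = 0) :
    ∃ Φ : S →+* L, (∀ s ∈ I, Φ s = 0) ∧ Φ.comp ψ = φ := by
  let := ψ.toAlgebra
  have : Algebra.IsIntegral R S := ⟨hψ⟩
  have : (RingHom.ker φ).IsPrime := RingHom.ker_isPrime φ
  -- Lying over: S/Q is then an integral extension of the domain R/ker φ, so it maps to L over it.
  obtain ⟨Q, hQI, hQ, hQP⟩ := Ideal.exists_ideal_over_prime_of_isIntegral (RingHom.ker φ) I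
    (fun r hr => h r hr)
  let : Algebra (R ⧸ RingHom.ker φ) (S ⧸ Q) := (Ideal.quotientMap Q ψ hQP.ge).toAlgebra
  let : Algebra (R ⧸ RingHom.ker φ) L := (RingHom.kerLift φ).toAlgebra
  have hinj : Function.Injective (algebraMap (R ⧸ RingHom.ker φ) (S ⧸ Q)) :=
    Ideal.quotientMap_injective' hQP.le
  have : FaithfulSMul (R ⧸ RingHom.ker φ) (S ⧸ Q) :=
    (faithfulSMul_iff_algebraMap_injective _ _).2 hinj
  have : FaithfulSMul (R ⧸ RingHom.ker φ) L :=
    (faithfulSMul_iff_algebraMap_injective _ _).2 (RingHom.kerLift_injective φ)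
  have : Algebra.IsIntegral (R ⧸ RingHom.ker φ) (S ⧸ Q) :=
    ⟨fun s => by
      obtain ⟨s, rfl⟩ := Ideal.Quotient.mk_surjective s
      obtain ⟨p, hp, hp0⟩ := hψ s
      refine ⟨p.map (Ideal.Quotient.mk _), hp.map _, ?_⟩
      rw [Polynomial.eval₂_map]
      have : (algebraMap (R ⧸ RingHom.ker φ) (S ⧸ Q)).comp (Ideal.Quotient.mk _) =
        (Ideal.Quotient.mk Q).comp ψ := by ext; rfl
      rw [this, ← Polynomial.hom_eval₂, hp0, map_zero]⟩
  have : IsDomain (R ⧸ RingHom.ker φ) := Ideal.Quotient.isDomain _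
  have : IsDomain (S ⧸ Q) := Ideal.Quotient.isDomain _
  have : Module.IsTorsionFree (R ⧸ RingHom.ker φ) (S ⧸ Q) :=
    FaithfulSMul.to_isTorsionFree _ _
  let Λ : (S ⧸ Q) →ₐ[R ⧸ RingHom.ker φ] L := IsAlgClosed.lift
  refine ⟨Λ.toRingHom.comp (Ideal.Quotient.mk Q), fun s hs => ?_, ?_⟩
  · simp [Ideal.Quotient.eq_zero_iff_mem.2 (hQI hs)]
  · ext r
    exact Λ.commutes (Ideal.Quotient.mk _ r)

/-- Every element of a divisible abelian group is the image of `1` under a homomorphism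
from `ℚ`; here for the units of an algebraically closed field. -/
theorem IsAlgClosed.exists_rat_monoidHom {L : Type*} [Field L] [IsAlgClosed L] (a : Lˣ) :
    ∃ χ : Multiplicative ℚ →* Lˣ, χ (Multiplicative.ofAdd 1) = a := by
  let : DivisibleBy (Additive Lˣ) ℤ := by
    have : RootableBy Lˣ ℕ := rootableByOfPowLeftSurj _ _ fun {k} hk b => by
      obtain ⟨c, hc⟩ := IsAlgClosed.exists_pow_nat_eq (b : L) (Nat.pos_of_ne_zero hk)
      have hc0 : c ≠ 0 := by
        rintro rfl
        rw [zero_pow hk] at hc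
        exact b.ne_zero hc.symm
      exact ⟨Units.mk0 c hc0, Units.ext (by simpa using hc)⟩
    have : RootableBy Lˣ ℤ := Group.rootableByIntOfRootableByNat Lˣ
    exact
      { div := fun a n => Additive.ofMul (RootableBy.root a.toMul n)
        div_zero := fun a => congrArg Additive.ofMul (RootableBy.root_zero a.toMul)
        div_cancel := fun a hn => congrArg Additive.ofMul (RootableBy.root_cancel a.toMul hn) }
  -- Divisible groups are injective, so ℤ → Lˣ extends along ℤ ⊂ ℚ.
  obtain ⟨h, hh⟩ := (Module.Baer.of_divisible (Additive Lˣ)).extension_property_addMonoidHom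
    (Int.castAddHom ℚ) Int.cast_injective (zmultiplesHom (Additive Lˣ) (Additive.ofMul a))
  refine ⟨AddMonoidHom.toMultiplicativeLeft h, ?_⟩
  have := DFunLike.congr_fun hh 1
  simp only [AddMonoidHom.comp_apply, Int.coe_castAddHom, Int.cast_one, zmultiplesHom_apply,
    one_smul] at this
  simp [this]

/-- If a finite sum of nonzero terms vanishes, two of the terms have the same valuation. -/
theorem AddValuation.exists_ne_eq_of_sum_eq_zero {L Γ ι : Type*} [Field L]
    [LinearOrderedAddCommMonoidWithTop Γ] (v : AddValuation L Γ) {s : Finset ι} (hs : s.Nonempty) {T : ι → L}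
    (hT : ∀ p ∈ s, v (T p) ≠ ⊤) (h0 : ∑ p ∈ s, T p = 0) :
    ∃ p ∈ s, ∃ q ∈ s, p ≠ q ∧ v (T p) = v (T q) := by
  classical
  obtain ⟨p, hp, hmin⟩ := s.exists_min_image (fun p => v (T p)) hs
  by_contra! hcon
  have hlt := v.map_lt_sum (s := s.erase p) (f := T) (hT p hp) fun q hq =>
    lt_of_le_of_ne (hmin q (Finset.mem_of_mem_erase hq))
      (hcon p hp q (Finset.mem_of_mem_erase hq) (Finset.ne_of_mem_erase hq).symm)
  rw [← Finset.add_sum_erase s T hp] at h0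
  rw [eq_neg_of_add_eq_zero_left h0, v.map_neg] at hlt
  exact lt_irrefl _ hlt

/-- The kernel of a rational matrix with independent rows is spanned over `ℝ` by any rational
spanning set of its rational kernel. -/
theorem Matrix.exists_real_combination_of_mulVec_eq_zero {k n l : ℕ}
    {A : Matrix (Fin k) (Fin n) ℚ} (hA : LinearIndependent ℚ A.row) {u : Fin l → Fin n → ℚ}
    (hu : ∀ x : Fin n → ℚ, A.mulVec x = 0 → x ∈ Submodule.span ℚ (Set.range u))
    {x : Fin n → ℝ} (hx : (A.map (fun q : ℚ => (q : ℝ))).mulVec x = 0) :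
    ∃ t : Fin l → ℝ, ∀ i, x i = ∑ j, t j * (u j i : ℝ) := by
  obtain ⟨B, hB⟩ : ∃ B : Matrix (Fin n) (Fin k) ℚ, A * B = 1 := by
    rw [← Matrix.mulVec_surjective_iff_exists_right_inverse]
    have hr := hA.rank_matrix
    rw [Matrix.rank] at hr
    have : LinearMap.range A.mulVecLin = ⊤ := by
      apply Submodule.eq_top_of_finrank_eq
      simpa using hr
    exact LinearMap.range_eq_top.1 this
  -- 1 - BA is a rational projection onto the kernel of A. Its columns are rational combinations of
  -- u, and it fixes the real vector x.
  have hP : ∀ a, ∃ c : Fin l → ℚ, ∀ i, (1 - B * A : Matrix (Fin n) (Fin n) ℚ) i a = ∑ j, c j * u j i := by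
    intro a
    have h1 : A.mulVec ((1 - B * A : Matrix (Fin n) (Fin n) ℚ).col a) = 0 := by
      have : A * (1 - B * A) = 0 := by
        rw [Matrix.mul_sub, ← Matrix.mul_assoc, hB]; simp
      ext i
      exact congrFun (congrFun this i) a
    obtain ⟨c, hc⟩ := (Submodule.mem_span_range_iff_exists_fun ℚ).1 (hu _ h1)
    refine ⟨c, fun i => ?_⟩
    have := congrFun hc i
    simp only [Finset.sum_apply, Pi.smul_apply, smul_eq_mul] at this
    exact this.symm
  choose c hc using hP
  refine ⟨fun j => ∑ a, x a * c a j, fun i => ?_⟩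
  have key : x = ((1 - B * A : Matrix (Fin n) (Fin n) ℚ).map (Rat.castHom ℝ)).mulVec x := by
    have hx' : (A.map (Rat.castHom ℝ)).mulVec x = 0 := hx
    rw [Matrix.map_sub _ (by simp), Matrix.map_mul, Matrix.sub_mulVec, ← Matrix.mulVec_mulVec, hx']
    simp [Matrix.map_one]
  conv_lhs => rw [key]
  simp only [Matrix.mulVec, dotProduct, Matrix.map_apply, hc, Rat.coe_castHom, Rat.cast_sum,
    Rat.cast_mul, Finset.sum_mul]
  rw [Finset.sum_comm]
  exact Finset.sum_congr rfl fun j _ => Finset.sum_congr rfl fun a _ => by ring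

namespace TropProj

noncomputable section

/-! ### Evaluation of Laurent polynomials at torus points -/

section Eval

variable {K L : Type*} [Field K] [Field L] [Algebra K L] {n l : ℕ}

/-- The value at `(x, lam)` of the Laurent monomial with a given exponent. -/
def monomialAt (x : Fin n → L) (lam : Fin l → Lˣ) :
    Multiplicative ((Fin n →₀ ℕ) × (Fin l → ℤ)) →* L where
  toFun p := (∏ i, x i ^ p.toAdd.1 i) * ∏ j, ((lam j ^ p.toAdd.2 j : Lˣ) : L)
  map_one' := by simp
  map_mul' p q := by
    simp only [toAdd_mul, Prod.fst_add, Prod.snd_add, Finsupp.add_apply, Pi.add_apply, pow_add,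
      zpow_add, Units.val_mul, Finset.prod_mul_distrib]
    ring

/-- Evaluation of Laurent polynomials at a point `(x, lam)`. -/
def evalAt (K : Type*) [Field K] [Algebra K L] (x : Fin n → L) (lam : Fin l → Lˣ) :
    LRing K n l →ₐ[K] L :=
  AddMonoidAlgebra.lift K L _ (monomialAt x lam)

theorem monomialAt_apply (x : Fin n → L) (lam : Fin l → Lˣ) (p : (Fin n →₀ ℕ) × (Fin l → ℤ)) :
    monomialAt x lam (.ofAdd p) = (∏ i, x i ^ p.1 i) * ∏ j, ((lam j ^ p.2 j : Lˣ) : L) := rfl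

theorem monomialAt_ne_zero {x : Fin n → L} (hx : ∀ i, x i ≠ 0) (lam : Fin l → Lˣ)
    (p : (Fin n →₀ ℕ) × (Fin l → ℤ)) : monomialAt x lam (.ofAdd p) ≠ 0 := by
  rw [monomialAt_apply]
  exact mul_ne_zero (Finset.prod_ne_zero_iff.2 fun i _ => pow_ne_zero _ (hx i))
    (Finset.prod_ne_zero_iff.2 fun j _ => Units.ne_zero _)

theorem evalAt_apply (x : Fin n → L) (lam : Fin l → Lˣ) (g : LRing K n l) :
    evalAt K x lam g =
      ∑ p ∈ g.coeff.support, algebraMap K L (g.coeff p) * monomialAt x lam (.ofAdd p) :=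
  rfl

theorem evalAt_single (x : Fin n → L) (lam : Fin l → Lˣ) (p : (Fin n →₀ ℕ) × (Fin l → ℤ)) (c : K) :
    evalAt K x lam (AddMonoidAlgebra.single p c) =
      algebraMap K L c * monomialAt x lam (.ofAdd p) := by
  rw [evalAt, AddMonoidAlgebra.lift_single, Algebra.smul_def]

theorem evalAt_incl (x : Fin n → L) (lam : Fin l → Lˣ) (f : MvPolynomial (Fin n) K) :
    evalAt K x lam (incl K n l f) = MvPolynomial.aeval x f := by
  have : (evalAt K x lam).comp (incl K n l) = MvPolynomial.aeval x := by
    ext i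
    simp [incl, evalAt_single, monomialAt_apply, Finsupp.single_apply, pow_ite]
  exact DFunLike.congr_fun this f

theorem monomialAt_update (x : Fin n → L) (lam : Fin l → Lˣ) (i : Fin l) (μ : Lˣ)
    (p : (Fin n →₀ ℕ) × (Fin l → ℤ)) (hp : p.2 i = 0) :
    monomialAt x (Function.update lam i μ) (.ofAdd p) = monomialAt x lam (.ofAdd p) := by
  rw [monomialAt_apply, monomialAt_apply]
  congr 1
  refine Finset.prod_congr rfl fun j _ => ?_
  rcases eq_or_ne j i with rfl | h
  · simp [hp]
  · simp [h]

theorem evalAt_update (x : Fin n → L) (lam : Fin l → Lˣ) (i : Fin l) (μ : Lˣ) {g : LRing K n l}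
    (hg : g ∈ partialRing K n l i) :
    evalAt K x (Function.update lam i μ) g = evalAt K x lam g := by
  rw [evalAt_apply, evalAt_apply]
  exact Finset.sum_congr rfl fun p hp => by rw [monomialAt_update _ _ _ _ _ (hg p hp i le_rfl)]

theorem single_mem_partialRing {k : ℕ} {p : (Fin n →₀ ℕ) × (Fin l → ℤ)}
    (hp : ∀ j : Fin l, k ≤ (j : ℕ) → p.2 j = 0) (c : K) :
    AddMonoidAlgebra.single p c ∈ partialRing K n l k := by
  intro q hq
  obtain rfl : q = p := by
    simpa using Finsupp.support_single_subset hq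
  exact hp

theorem sum_single_coeff (g : LRing K n l) :
    ∑ p ∈ g.coeff.support, AddMonoidAlgebra.single p (g.coeff p) = g :=
  AddMonoidAlgebra.sum_coeff_single g

end Eval

/-! ### Extending a zero by one more variable λᵢ -/

section Extension

variable {K L : Type*} [Field K] [Field L] [Algebra K L] {n l : ℕ}

/-- The homomorphism from polynomials over `K[x, λ₁^{±1}, …, λᵢ₋₁^{±1}]` to the Laurent polynomial
ring which sends the indeterminate to `λᵢ`. -/
def adjoinNext (K : Type*) [Field K] (n : ℕ) {l : ℕ} (i : Fin l) :
    Polynomial (partialRing K n l i) →+* LRing K n l :=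
  Polynomial.eval₂RingHom (partialRing K n l i).val.toRingHom
    (AddMonoidAlgebra.single (0, Pi.single i 1) 1)

theorem adjoinNext_monomial (i : Fin l) (k : ℕ) (c : partialRing K n l i) :
    adjoinNext K n i (Polynomial.monomial k c) =
      c.1 * AddMonoidAlgebra.single (0, Pi.single i (k : ℤ)) 1 := by
  simp [adjoinNext, Polynomial.eval₂_monomial, AddMonoidAlgebra.single_pow, ← Pi.single_smul]

theorem evalAt_adjoinNext (x : Fin n → L) (lam : Fin l → Lˣ) (i : Fin l) (μ : Lˣ)
    (G : Polynomial (partialRing K n l i)) :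
    evalAt K x (Function.update lam i μ) (adjoinNext K n i G) =
      G.eval₂ ((evalAt K x lam).comp (partialRing K n l i).val).toRingHom (μ : L) := by
  induction G using Polynomial.induction_on' with
  | add p q hp hq => simp only [map_add, hp, hq, Polynomial.eval₂_add]
  | monomial k c =>
    rw [adjoinNext_monomial, map_mul, evalAt_update _ _ _ _ c.2, evalAt_single,
      Polynomial.eval₂_monomial, monomialAt_apply]
    congr 1
    rw [Finset.prod_eq_one (by simp), Finset.prod_eq_single i (by
      intro j _ hj; simp [hj]) (by simp)]
    simp

/-- After multiplication by a power of `λᵢ`, a Laurent polynomial in `x, λ₁, …, λᵢ` becomes a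
polynomial in `λᵢ`. -/
theorem exists_adjoinNext_eq (i : Fin l) {g : LRing K n l} (hg : g ∈ partialRing K n l (i + 1))
    (N : ℤ) (hN : ∀ p ∈ g.coeff.support, 0 ≤ p.2 i + N) :
    ∃ G : Polynomial (partialRing K n l i),
      adjoinNext K n i G = AddMonoidAlgebra.single (0, Pi.single i N) 1 * g ∧
      ∀ k : ℕ, ((G.coeff k : partialRing K n l i) : LRing K n l) =
        ∑ p ∈ g.coeff.support with p.2 i + N = k,
          AddMonoidAlgebra.single (p.1, Function.update p.2 i 0) (g.coeff p) := by
  classical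
  have hmem : ∀ p ∈ g.coeff.support,
      AddMonoidAlgebra.single (p.1, Function.update p.2 i 0) (g.coeff p) ∈
        partialRing K n l i := by
    intro p hp
    refine single_mem_partialRing (fun j hj => ?_) _
    rcases eq_or_ne j i with rfl | h
    · simp
    · have : (i : ℕ) ≠ j := fun h' => h (Fin.ext h'.symm)
      simpa [h] using hg p hp j (by omega)
  refine ⟨∑ p ∈ g.coeff.support.attach,
    Polynomial.monomial (p.1.2 i + N).toNat ⟨_, hmem p.1 p.2⟩, ?_, fun k => ?_⟩
  · rw [map_sum]
    simp only [adjoinNext_monomial]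
    rw [Finset.sum_attach g.coeff.support (fun p =>
      AddMonoidAlgebra.single (p.1, Function.update p.2 i 0) (g.coeff p) *
        AddMonoidAlgebra.single ((0, Pi.single i ((p.2 i + N).toNat : ℤ)) :
          (Fin n →₀ ℕ) × (Fin l → ℤ)) (1 : K))]
    conv_rhs => rw [← sum_single_coeff g, Finset.mul_sum]
    refine Finset.sum_congr rfl fun p hp => ?_
    rw [AddMonoidAlgebra.single_mul_single, AddMonoidAlgebra.single_mul_single,
      Int.toNat_of_nonneg (hN p hp)]
    congr 1
    · ext j
      · simp
      · rcases eq_or_ne j i with rfl | h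
        · simp [add_comm]
        · simp [h]
    · simp
  · rw [Polynomial.finsetSum_coeff]
    simp only [Polynomial.coeff_monomial]
    rw [AddSubmonoidClass.coe_finsetSum]
    rw [Finset.sum_filter, ← Finset.sum_attach g.coeff.support]
    refine Finset.sum_congr rfl fun p _ => ?_
    have := hN p.1 p.2
    have hiff : (p.1.2 i + N).toNat = k ↔ p.1.2 i + N = k := by omega
    simp only [hiff]
    split_ifs <;> rfl

/-- A zero of `J ∩ K[x, λ₁^{±1}, …, λᵢ₋₁^{±1}]` in the torus extends to a zero of
`J ∩ K[x, λ₁^{±1}, …, λᵢ^{±1}]` in the torus as soon as the latter ideal contains a nonzero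
element in which the coefficients of the powers of `λᵢ` are monomials. -/
theorem exists_update_of_monomial_coeffs [IsAlgClosed L] (J : Ideal (LRing K n l)) (i : Fin l)
    {f : LRing K n l} (hfJ : f ∈ J) (hf : f ∈ partialRing K n l (i + 1)) (hf0 : f ≠ 0)
    (hmono : ∀ p ∈ f.coeff.support, ∀ q ∈ f.coeff.support, p.2 i = q.2 i → p = q)
    {x : Fin n → L} (hx : ∀ j, x j ≠ 0) (lam : Fin l → Lˣ)
    (h : ∀ g ∈ J, g ∈ partialRing K n l i → evalAt K x lam g = 0) :
    ∃ μ : Lˣ, ∀ g ∈ J, g ∈ partialRing K n l (i + 1) →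
      evalAt K x (Function.update lam i μ) g = 0 := by
  classical
  set φ := ((evalAt K x lam).comp (partialRing K n l i).val).toRingHom with hφ
  have hne : f.coeff.support.Nonempty := by
    rw [Finsupp.support_nonempty_iff]
    exact fun h0 => hf0 (AddMonoidAlgebra.coeff_injective h0)
  obtain ⟨p₀, hp₀, hmin⟩ := f.coeff.support.exists_min_image (fun p => p.2 i) hne
  -- Shifting by the lowest exponent of λᵢ makes the lowest coefficient of f the constant term of F.
  obtain ⟨F, hF, hFc⟩ := exists_adjoinNext_eq i hf (-p₀.2 i)
    (fun p hp => by have := hmin p hp; omega)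
  have hterm : ∀ p ∈ f.coeff.support, algebraMap K L (f.coeff p) *
      monomialAt x lam (.ofAdd (p.1, Function.update p.2 i 0)) ≠ 0 := fun p hp =>
    mul_ne_zero ((map_ne_zero _).2 (Finsupp.mem_support_iff.1 hp)) (monomialAt_ne_zero hx _ _)
  -- Only one term of f contributes to such a coefficient, so its value is a nonzero scalar times a
  -- monomial on the torus.
  have hφc : ∀ k : ℕ, ∀ p ∈ f.coeff.support, p.2 i + -p₀.2 i = k → φ (F.coeff k) ≠ 0 := by
    intro k p hp hk
    have : φ (F.coeff k) = evalAt K x lam (F.coeff k : LRing K n l) := rfl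
    rw [this, hFc k, Finset.sum_eq_single_of_mem p (by simp only [Finset.mem_filter]; exact ⟨hp, hk⟩),
      evalAt_single]
    · exact hterm p hp
    · intro q hq hqp
      simp only [Finset.mem_filter] at hq
      exact absurd (hmono q hq.1 p hp (by omega)) hqp
  have hFne : F ≠ 0 := by
    rintro rfl
    exact hφc 0 p₀ hp₀ (by simp) (by simp)
  have hlc : φ F.leadingCoeff ≠ 0 := by
    have h0 := Polynomial.leadingCoeff_ne_zero.2 hFne
    obtain ⟨p, hp⟩ : ({p ∈ f.coeff.support | p.2 i + -p₀.2 i = (F.natDegree : ℤ)}).Nonempty := by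
      by_contra hem
      rw [Finset.not_nonempty_iff_eq_empty] at hem
      apply h0
      apply Subtype.ext
      have := hFc F.natDegree
      rw [hem, Finset.sum_empty] at this
      exact this
    simp only [Finset.mem_filter] at hp
    exact hφc _ p hp.1 hp.2
  have hFJ : F ∈ J.comap (adjoinNext K n i) := by
    rw [Ideal.mem_comap, hF]
    exact J.mul_mem_left _ hfJ
  obtain ⟨μ, hμ⟩ := Ideal.exists_eval₂_eq_zero_of_leadingCoeff φ (J.comap (adjoinNext K n i))
    (fun c hc => h _ (by simpa [adjoinNext] using hc) c.2) hFJ hlc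
  have hμ0 : μ ≠ 0 := by
    rintro rfl
    have := hμ F hFJ
    rw [Polynomial.eval₂_at_zero] at this
    exact hφc 0 p₀ hp₀ (by simp) this
  refine ⟨Units.mk0 μ hμ0, fun g hgJ hg => ?_⟩
  obtain ⟨N, hN⟩ : ∃ N : ℤ, ∀ p ∈ g.coeff.support, 0 ≤ p.2 i + N :=
    ⟨∑ p ∈ g.coeff.support, |p.2 i|, fun p hp => by
      have := Finset.single_le_sum (f := fun p : (Fin n →₀ ℕ) × (Fin l → ℤ) => |p.2 i|)
        (fun q _ => abs_nonneg _) hp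
      have h2 := neg_abs_le (p.2 i)
      omega⟩
  obtain ⟨G, hG, -⟩ := exists_adjoinNext_eq i hg N hN
  have h1 := evalAt_adjoinNext x lam i (Units.mk0 μ hμ0) G
  rw [hG, map_mul, evalAt_single, Units.val_mk0, hμ G (by
    rw [Ideal.mem_comap, hG]; exact J.mul_mem_left _ hgJ)] at h1
  refine (mul_eq_zero.1 h1).resolve_left ?_
  rw [map_one, one_mul]
  exact monomialAt_ne_zero hx _ _

end Extension

/-! ### The valuation as a real-valued function -/

section RealOrd

variable {L : Type*} [Field L] (ord : AddValuation L (WithTop ℝ))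

/-- The valuation as a real number, with the value `0` at zero. -/
def realOrd (z : L) : ℝ := (ord z).untopD 0

variable {ord}

theorem ord_eq_realOrd {z : L} (hz : z ≠ 0) : ord z = (realOrd ord z : WithTop ℝ) := by
  obtain ⟨r, hr⟩ := WithTop.ne_top_iff_exists.1 ((ord.ne_top_iff).2 hz)
  rw [realOrd, ← hr, WithTop.untopD_coe]

theorem ord_eq_coe_iff {z : L} {r : ℝ} : ord z = (r : WithTop ℝ) ↔ z ≠ 0 ∧ realOrd ord z = r := by
  constructor
  · intro h
    refine ⟨?_, by rw [realOrd, h, WithTop.untopD_coe]⟩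
    rintro rfl
    simp at h
  · rintro ⟨hz, rfl⟩
    exact ord_eq_realOrd hz

@[simp]
theorem realOrd_one : realOrd ord (1 : L) = 0 := by
  simp [realOrd]

theorem realOrd_mul {a b : L} (ha : a ≠ 0) (hb : b ≠ 0) :
    realOrd ord (a * b) = realOrd ord a + realOrd ord b := by
  have := ord.map_mul a b
  rw [ord_eq_realOrd ha, ord_eq_realOrd hb, ord_eq_realOrd (mul_ne_zero ha hb)] at this
  exact_mod_cast this

/-- The real-valued valuation as a homomorphism on units. -/
def unitsOrd (ord : AddValuation L (WithTop ℝ)) : Lˣ →* Multiplicative ℝ where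
  toFun z := .ofAdd (realOrd ord (z : L))
  map_one' := by simp
  map_mul' a b := by simp [realOrd_mul]

theorem realOrd_units_zpow (a : Lˣ) (k : ℤ) :
    realOrd ord ((a ^ k : Lˣ) : L) = k * realOrd ord (a : L) := by
  have := congrArg Multiplicative.toAdd (map_zpow (unitsOrd ord) a k)
  simpa [unitsOrd] using this

theorem realOrd_pow {a : L} (ha : a ≠ 0) (k : ℕ) :
    realOrd ord (a ^ k) = k * realOrd ord a := by
  simpa using realOrd_units_zpow (ord := ord) (Units.mk0 a ha) k

theorem realOrd_prod {ι : Type*} (s : Finset ι) {a : ι → L} (ha : ∀ i, a i ≠ 0) :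
    realOrd ord (∏ i ∈ s, a i) = ∑ i ∈ s, realOrd ord (a i) := by
  classical
  induction s using Finset.induction_on with
  | empty => simp
  | insert i s hi ih =>
    rw [Finset.prod_insert hi, Finset.sum_insert hi, realOrd_mul (ha i)
      (Finset.prod_ne_zero_iff.2 fun i _ => ha i), ih]

/-- Additive maps between rational vector spaces are ℚ-linear. -/
theorem realOrd_rat (χ : Multiplicative ℚ →* Lˣ) (q : ℚ) :
    realOrd ord (χ (.ofAdd q) : L) = q * realOrd ord (χ (.ofAdd 1) : L) := by
  have := map_rat_smul (AddMonoidHom.toMultiplicative.symm ((unitsOrd ord).comp χ)) q 1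
  simpa [unitsOrd, Rat.smul_def] using this

variable {n l : ℕ}

theorem realOrd_monomialAt {x : Fin n → L} (hx : ∀ i, x i ≠ 0) (lam : Fin l → Lˣ)
    (p : (Fin n →₀ ℕ) × (Fin l → ℤ)) :
    realOrd ord (monomialAt x lam (.ofAdd p)) =
      ∑ i, p.1 i * realOrd ord (x i) + ∑ j, p.2 j * realOrd ord (lam j : L) := by
  rw [monomialAt_apply, realOrd_mul (Finset.prod_ne_zero_iff.2 fun i _ => pow_ne_zero _ (hx i))
    (Finset.prod_ne_zero_iff.2 fun j _ => Units.ne_zero _),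
    realOrd_prod _ (fun i => pow_ne_zero _ (hx i)), realOrd_prod _ (fun i => Units.ne_zero _)]
  simp only [realOrd_pow (hx _), realOrd_units_zpow]

end RealOrd

/-! ### Uniform bounds on the valuations of the λᵢ -/

section Bounds

variable {K L : Type*} [Field K] [Field L] [Algebra K L] {n l : ℕ}
  (ord : AddValuation L (WithTop ℝ))

/-- If the coefficients of the powers of `λᵢ` in `f ≠ 0` are monomials, then the valuation of
`λᵢ` at the zeros of `f` in the torus is bounded in terms of the valuations of the other
coordinates. -/
theorem exists_bound_realOrd {i : Fin l} {f : LRing K n l}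
    (hf0 : f ≠ 0)
    (hmono : ∀ p ∈ f.coeff.support, ∀ q ∈ f.coeff.support, p.2 i = q.2 i → p = q) (M : ℝ) :
    ∃ B : ℝ, ∀ (x : Fin n → L) (lam : Fin l → Lˣ), (∀ j, x j ≠ 0) →
      (∀ j, |realOrd ord (x j)| ≤ M) → (∀ j, j ≠ i → |realOrd ord (lam j : L)| ≤ M) →
      evalAt K x lam f = 0 → |realOrd ord (lam i : L)| ≤ B := by
  classical
  -- `b p` bounds the valuation of the term p with its factor in λᵢ left out.
  set b : (Fin n →₀ ℕ) × (Fin l → ℤ) → ℝ := fun p =>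
    |realOrd ord (algebraMap K L (f.coeff p))| + (∑ j, (p.1 j : ℝ) * |M| + ∑ j, |(p.2 j : ℝ)| * |M|)
    with hb
  have hb0 : ∀ p, 0 ≤ b p := fun p => by positivity
  refine ⟨∑ p ∈ f.coeff.support, b p + ∑ p ∈ f.coeff.support, b p,
    fun x lam hx hxM hlM h0 => ?_⟩
  have hne : f.coeff.support.Nonempty := by
    rw [Finsupp.support_nonempty_iff]
    exact fun h0 => hf0 (AddMonoidAlgebra.coeff_injective h0)
  have hc : ∀ p ∈ f.coeff.support, algebraMap K L (f.coeff p) ≠ 0 := fun p hp =>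
    (map_ne_zero _).2 (Finsupp.mem_support_iff.1 hp)
  have hm := monomialAt_ne_zero hx lam
  rw [evalAt_apply] at h0
  obtain ⟨p, hp, q, hq, hpq, heq⟩ := ord.exists_ne_eq_of_sum_eq_zero hne
    (fun p hp => (ord.ne_top_iff).2 (mul_ne_zero (hc p hp) (hm p))) h0
  set t := realOrd ord (lam i : L)
  have hval : ∀ p ∈ f.coeff.support, ∃ a : ℝ, |a| ≤ b p ∧
      realOrd ord (algebraMap K L (f.coeff p) * monomialAt x lam (.ofAdd p)) = a + p.2 i * t := by
    intro p hp
    refine ⟨realOrd ord (algebraMap K L (f.coeff p)) + (∑ j, p.1 j * realOrd ord (x j) +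
      ∑ j ∈ Finset.univ.erase i, p.2 j * realOrd ord (lam j : L)), ?_, ?_⟩
    · refine (abs_add_le _ _).trans (add_le_add le_rfl ((abs_add_le _ _).trans (add_le_add ?_ ?_)))
      · refine (Finset.abs_sum_le_sum_abs _ _).trans (Finset.sum_le_sum fun j _ => ?_)
        rw [abs_mul, Nat.abs_cast]
        exact mul_le_mul_of_nonneg_left ((hxM j).trans (le_abs_self M)) (Nat.cast_nonneg _)
      · refine (Finset.abs_sum_le_sum_abs _ _).trans ?_
        refine le_trans (Finset.sum_le_sum fun j hj => ?_)
          (Finset.sum_le_sum_of_subset_of_nonneg (Finset.erase_subset i Finset.univ)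
            fun j _ _ => mul_nonneg (abs_nonneg _) (abs_nonneg _))
        rw [abs_mul]
        exact mul_le_mul_of_nonneg_left ((hlM j (Finset.ne_of_mem_erase hj)).trans (le_abs_self M))
          (abs_nonneg _)
    · rw [realOrd_mul (hc p hp) (hm p), realOrd_monomialAt hx,
        ← Finset.sum_erase_add _ _ (Finset.mem_univ i)]
      ring
  obtain ⟨a, ha, hpa⟩ := hval p hp
  obtain ⟨c, hc', hqc⟩ := hval q hq
  have hE : a + p.2 i * t = c + q.2 i * t := by
    rw [← hpa, ← hqc, realOrd, realOrd, heq]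
  have hdiff : ((p.2 i - q.2 i : ℤ) : ℝ) * t = c - a := by push_cast; linarith
  -- The two terms carry different integer exponents of λᵢ, so equating their valuations bounds ord
  -- λᵢ by the difference of the remaining parts.
  have hone : (1 : ℝ) ≤ |((p.2 i - q.2 i : ℤ) : ℝ)| := by
    rw [← Int.cast_abs]
    exact_mod_cast Int.one_le_abs (sub_ne_zero.2 fun h => hpq (hmono p hp q hq h))
  calc |t| ≤ |((p.2 i - q.2 i : ℤ) : ℝ)| * |t| := le_mul_of_one_le_left (abs_nonneg _) hone
    _ = |c - a| := by rw [← abs_mul, hdiff]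
    _ ≤ |c| + |a| := abs_sub _ _
    _ ≤ b q + b p := add_le_add hc' ha
    _ ≤ _ := add_le_add (Finset.single_le_sum (fun p _ => hb0 p) hq)
        (Finset.single_le_sum (fun p _ => hb0 p) hp)

theorem incl_monomial (a : Fin n →₀ ℕ) (c : K) :
    incl K n l (MvPolynomial.monomial a c) = AddMonoidAlgebra.single (a, 0) c := by
  have h1 : ∀ a : Fin n →₀ ℕ, incl K n l (MvPolynomial.monomial a 1) =
      AddMonoidAlgebra.single (a, 0) 1 := by
    intro a
    induction a using Finsupp.induction_linear with
    | zero =>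
      rw [← MvPolynomial.C_apply, map_one, map_one]
      rfl
    | add a b ha hb =>
      rw [← one_mul (1 : K), ← MvPolynomial.monomial_mul, map_mul, ha, hb,
        AddMonoidAlgebra.single_mul_single]
      simp
    | single i k =>
      rw [← MvPolynomial.X_pow_eq_monomial, map_pow, incl, MvPolynomial.aeval_X,
        AddMonoidAlgebra.single_pow]
      simp
  rw [← mul_one c, ← smul_eq_mul, ← MvPolynomial.smul_monomial, map_smul, h1]
  simp

/-- A Laurent polynomial in which no `λⱼ` occurs is an ordinary polynomial. -/
theorem exists_incl_eq {g : LRing K n l} (hg : g ∈ partialRing K n l 0) :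
    ∃ f, incl K n l f = g := by
  refine ⟨∑ p ∈ g.coeff.support, MvPolynomial.monomial p.1 (g.coeff p), ?_⟩
  conv_rhs => rw [← sum_single_coeff g]
  rw [map_sum]
  refine Finset.sum_congr rfl fun p hp => ?_
  have hp2 : p.2 = 0 := funext fun j => hg p hp j (Nat.zero_le _)
  rw [incl_monomial, ← hp2]

/-- Under algebraic regularity the zeros of the elimination ideal in the torus extend to zeros of
`J` in the torus, with a uniform bound on the valuations of the new coordinates. -/
theorem exists_extension_le [IsAlgClosed L] {u : Fin l → Fin n → ℚ}
    {I : Ideal (MvPolynomial (Fin n) K)} (hreg : AlgRegular u I) (M : ℝ) (k : ℕ) (hk : k ≤ l) :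
    ∃ B : ℝ, ∀ x : Fin n → L, (∀ j, x j ≠ 0) → (∀ j, |realOrd ord (x j)| ≤ M) →
      (∀ f ∈ elimIdeal (twistIdeal u I), MvPolynomial.aeval x f = 0) →
      ∃ lam : Fin l → Lˣ, (∀ j, |realOrd ord (lam j : L)| ≤ B) ∧
        ∀ g ∈ twistIdeal u I, g ∈ partialRing K n l k → evalAt K x lam g = 0 := by
  induction k with
  | zero =>
    refine ⟨0, fun x _ _ hx => ⟨1, by simp, fun g hgJ hg => ?_⟩⟩
    obtain ⟨f, rfl⟩ := exists_incl_eq hg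
    rw [evalAt_incl]
    exact hx f hgJ
  | succ k ih =>
    obtain ⟨B, hB⟩ := ih (by omega)
    obtain ⟨F, hspan, hF⟩ := hreg ⟨k, hk⟩
    by_cases hF0 : ∃ f ∈ F, f ≠ 0
    · obtain ⟨f, hfF, hf0⟩ := hF0
      have hf : f ∈ (twistIdeal u I : Set (LRing K n l)) ∩ (partialRing K n l (k + 1) : Set _) := by
        rw [← hspan]
        exact Submodule.subset_span hfF
      obtain ⟨B', hB'⟩ := exists_bound_realOrd (L := L) ord hf0 (hF f hfF) (max M B)
      refine ⟨max B B', fun x hx0 hxM hx => ?_⟩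
      obtain ⟨lam, hlam, hz⟩ := hB x hx0 hxM hx
      obtain ⟨μ, hμ⟩ := exists_update_of_monomial_coeffs (twistIdeal u I) ⟨k, hk⟩ hf.1 hf.2 hf0
        (hF f hfF) hx0 lam hz
      refine ⟨Function.update lam ⟨k, hk⟩ μ, fun j => ?_, hμ⟩
      rcases eq_or_ne j ⟨k, hk⟩ with rfl | hj
      · refine le_max_of_le_right (hB' x _ hx0 (fun j => le_max_of_le_left (hxM j))
          (fun j hj => ?_) (hμ f hf.1 hf.2))
        rw [Function.update_of_ne hj]
        exact le_max_of_le_right (hlam j)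
      · rw [Function.update_of_ne hj]
        exact le_max_of_le_left (hlam j)
    -- Here the elimination ideal is zero and imposes no condition, so the old point serves
    -- unchanged.
    · push Not at hF0
      refine ⟨B, fun x hx0 hxM hx => ?_⟩
      obtain ⟨lam, hlam, -⟩ := hB x hx0 hxM hx
      refine ⟨lam, hlam, fun g hgJ hg => ?_⟩
      have hmem : g ∈ (Submodule.span (partialRing K n l (k + 1)) (F : Set (LRing K n l)) :
          Set (LRing K n l)) := by
        rw [hspan]
        exact ⟨hgJ, hg⟩
      have hbot : Submodule.span (partialRing K n l (k + 1)) (F : Set (LRing K n l)) = ⊥ :=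
        Submodule.span_eq_bot.2 hF0
      rw [hbot] at hmem
      rw [(Submodule.mem_bot _).1 hmem, map_zero]

end Bounds

/-! ### Passing between zeros of I and zeros of J -/

section Points

variable {K L : Type*} [Field K] [Field L] [Algebra K L] {n l : ℕ}

/-- If `(x, lam)` is a zero of `J`, then `x` is a zero of `elimIdeal J`. -/
theorem aeval_eq_zero_of_mem_elimIdeal {J : Ideal (LRing K n l)} {x : Fin n → L}
    {lam : Fin l → Lˣ} (h : ∀ g ∈ J, evalAt K x lam g = 0) {f : MvPolynomial (Fin n) K}
    (hf : f ∈ elimIdeal J) : MvPolynomial.aeval x f = 0 := by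
  rw [← evalAt_incl x lam]
  exact h _ hf

/-- A zero `z` of `I` gives zeros of the twisted ideal. -/
theorem evalAt_eq_zero_of_mem_twistIdeal (u : Fin l → Fin n → ℚ)
    {I : Ideal (MvPolynomial (Fin n) K)} {z : Fin n → L}
    (hz : ∀ f ∈ I, MvPolynomial.aeval z f = 0) (χ : Multiplicative ℚ →* Lˣ) (q : Fin l → ℚ)
    {g : LRing K n l} (hg : g ∈ twistIdeal u I) :
    evalAt K (fun i => z i * (χ (.ofAdd (-∑ j, q j * u j i)) : L)) (fun j => χ (.ofAdd (q j))) g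
      = 0 := by
  set x : Fin n → L := fun i => z i * (χ (.ofAdd (-∑ j, q j * u j i)) : L) with hx
  set lam : Fin l → Lˣ := fun j => χ (.ofAdd (q j)) with hlam
  -- Reading λ^γ as χ(∑ qⱼ γⱼ) gives a consistent choice of all rational powers, hence an evaluation
  -- on `QRing`.
  let m : Multiplicative ((Fin n →₀ ℕ) × (Fin l → ℚ)) →* L :=
    { toFun := fun p => (∏ i, x i ^ p.toAdd.1 i) * (χ (.ofAdd (∑ j, q j * p.toAdd.2 j)) : L)
      map_one' := by simp
      map_mul' := fun p p' => by
        simp only [toAdd_mul, Prod.fst_add, Prod.snd_add, Finsupp.add_apply, Pi.add_apply, pow_add,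
          mul_add, Finset.sum_add_distrib, ofAdd_add, map_mul, Units.val_mul,
          Finset.prod_mul_distrib]
        ring }
  let E : QRing K n l →ₐ[K] L := AddMonoidAlgebra.lift K L _ m
  have hE : ∀ p c, E (AddMonoidAlgebra.single p c) = algebraMap K L c * m (.ofAdd p) := fun p c => by
    simp only [E]
    rw [AddMonoidAlgebra.lift_single, Algebra.smul_def]
  have hm : ∀ p : (Fin n →₀ ℕ) × (Fin l → ℚ), m (.ofAdd p) =
    (∏ i, x i ^ p.1 i) * (χ (.ofAdd (∑ j, q j * p.2 j)) : L) := fun p => rfl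
  have h1 : E.comp (twist u) = MvPolynomial.aeval z := by
    ext i
    simp only [AlgHom.comp_apply, twist, MvPolynomial.aeval_X, hE, hm]
    rw [Finset.prod_eq_single i (by intro j _ hj; simp [hj.symm]) (by simp)]
    simp only [hx, map_one, one_mul, Finsupp.single_eq_same, pow_one, ofAdd_neg, map_inv, mul_assoc]
    rw [Units.inv_mul, mul_one]
  have h2 : ∀ g : LRing K n l, E (toQ K n l g) = evalAt K x lam g := by
    intro g
    induction g using AddMonoidAlgebra.induction_linear with
    | zero => simp
    | add f g hf hg => simp only [map_add, hf, hg]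
    | single p c =>
      rw [evalAt_single, toQ]
      simp only [AddMonoidAlgebra.mapDomainRingHom_apply, AddMonoidAlgebra.mapDomain_single, hE, hm,
        monomialAt_apply]
      congr 2
      simp only [hlam, ofAdd_sum, map_prod, Units.coe_prod]
      refine Finset.prod_congr rfl fun j _ => ?_
      rw [← map_zpow, ← ofAdd_zsmul]
      simp [mul_comm]
  have hle : twistIdeal u I ≤ RingHom.ker (evalAt K x lam).toRingHom := by
    refine Ideal.span_le.2 ?_
    rintro g ⟨f, hf, hgf⟩
    have := DFunLike.congr_fun h1 f
    rw [AlgHom.comp_apply, ← hgf, h2, hz f hf] at this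
    exact this
  exact hle hg

/-- A torus zero `(x, lam)` of the twisted ideal comes from a zero of `I` whose `N`-th powers are
the expected monomials in `x` and `lam`, where `N` is a common denominator of `u`. -/
theorem exists_zero_of_zero_twistIdeal [IsAlgClosed L] {u : Fin l → Fin n → ℚ}
    {I : Ideal (MvPolynomial (Fin n) K)} {N : ℕ} (hN : N ≠ 0) {U : Fin l → Fin n → ℤ}
    (hU : ∀ j i, (U j i : ℚ) = N * u j i) {x : Fin n → L} {lam : Fin l → Lˣ}
    (h : ∀ g ∈ twistIdeal u I, evalAt K x lam g = 0) :
    ∃ z : Fin n → L, (∀ f ∈ I, MvPolynomial.aeval z f = 0) ∧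
      ∀ i, z i ^ N = x i ^ N * ∏ j, ((lam j ^ U j i : Lˣ) : L) := by
  set y : Fin n → L := fun i => x i ^ N * ∏ j, ((lam j ^ U j i : Lˣ) : L) with hy
  -- κ sends f to f(x^N λ^{Nu}), the twist of f(x^N). Its exponents are integers, so it lands in J
  -- whenever f(x^N) ∈ I.
  let κ : MvPolynomial (Fin n) K →ₐ[K] LRing K n l := MvPolynomial.aeval fun i =>
    AddMonoidAlgebra.single (Finsupp.single i N, fun j => U j i) (1 : K)
  have h1 : ∀ f, evalAt K x lam (κ f) = MvPolynomial.aeval y f := by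
    have : (evalAt K x lam).comp κ = MvPolynomial.aeval y := by
      ext i
      simp only [κ, AlgHom.comp_apply, MvPolynomial.aeval_X, evalAt_single, monomialAt_apply]
      rw [Finset.prod_eq_single i (by intro j _ hj; simp [hj.symm]) (by simp)]
      simp [hy]
    exact DFunLike.congr_fun this
  have h2 : ∀ f, toQ K n l (κ f) = twist u (MvPolynomial.expand N f) := by
    have : (toQ K n l).comp κ.toRingHom =
        ((twist u).comp (MvPolynomial.expand N)).toRingHom := by
      refine MvPolynomial.ringHom_ext (fun c => ?_) fun i => ?_
      · simp [κ, toQ, twist]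
        congr 1
      · simp only [κ, toQ, twist, AlgHom.toRingHom_eq_coe, RingHom.comp_apply, RingHom.coe_coe,
          AlgHom.comp_apply, MvPolynomial.aeval_X, MvPolynomial.expand_X, map_pow,
          AddMonoidAlgebra.mapDomainRingHom_apply, AddMonoidAlgebra.mapDomain_single,
          AddMonoidAlgebra.single_pow, one_pow]
        congr 1
        ext j
        · simp
        · simp [hU]
    exact DFunLike.congr_fun this
  have hint : ((MvPolynomial.expand N : MvPolynomial (Fin n) K →ₐ[K] _) :
      MvPolynomial (Fin n) K →+* MvPolynomial (Fin n) K).IsIntegral := by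
    intro p
    induction p using MvPolynomial.induction_on with
    | C c =>
      have := RingHom.isIntegralElem_map ((MvPolynomial.expand N : MvPolynomial (Fin n) K →ₐ[K] _) :
        MvPolynomial (Fin n) K →+* MvPolynomial (Fin n) K) (x := MvPolynomial.C c)
      simpa using this
    | add p q hp hq => exact RingHom.IsIntegralElem.add _ hp hq
    | mul_X p i hp =>
      refine RingHom.IsIntegralElem.mul _ hp ?_
      refine ⟨Polynomial.X ^ N - Polynomial.C (MvPolynomial.X i),
        Polynomial.monic_X_pow_sub_C _ hN, ?_⟩
      simp [MvPolynomial.expand_X]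
  obtain ⟨Φ, hΦI, hΦ⟩ := hint.exists_extension I (MvPolynomial.aeval y).toRingHom
    (fun f hf => (h1 f).symm.trans (h _ (Ideal.subset_span ⟨_, hf, h2 f⟩)))
  have hΦz : Φ = (MvPolynomial.aeval fun i => Φ (MvPolynomial.X i) :
      MvPolynomial (Fin n) K →ₐ[K] L).toRingHom := by
    refine MvPolynomial.ringHom_ext (fun c => ?_) fun i => by simp
    have := DFunLike.congr_fun hΦ (MvPolynomial.C c)
    simpa [MvPolynomial.expand_C] using this
  refine ⟨fun i => Φ (MvPolynomial.X i), fun f hf => ?_, fun i => ?_⟩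
  · exact (DFunLike.congr_fun hΦz f).symm.trans (hΦI f hf)
  · have := DFunLike.congr_fun hΦ (MvPolynomial.X i)
    simpa [MvPolynomial.expand_X, hy] using this

end Points

/-! ### The linear projection -/

section Projection

theorem continuous_proj {k n : ℕ} (A : Matrix (Fin k) (Fin n) ℚ) : Continuous (proj A) := by
  unfold proj
  fun_prop

theorem proj_sub {k n : ℕ} (A : Matrix (Fin k) (Fin n) ℚ) (x y : Fin n → ℝ) :
    proj A (x - y) = proj A x - proj A y :=
  Matrix.mulVec_sub _ _ _

theorem proj_add_combination {k n l : ℕ} {A : Matrix (Fin k) (Fin n) ℚ} {u : Fin l → Fin n → ℚ}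
    (hu : ∀ j i, A.row i ⬝ᵥ u j = 0) (x : Fin n → ℝ) (t : Fin l → ℝ) :
    proj A (fun i => x i + ∑ j, t j * (u j i : ℝ)) = proj A x := by
  ext a
  have h : ∀ j, ∑ i, (A a i : ℝ) * (u j i : ℝ) = 0 := fun j => by
    have := hu j a
    simp only [dotProduct, Matrix.row] at this
    exact_mod_cast this
  simp only [proj, Matrix.mulVec, dotProduct, Matrix.map_apply, mul_add, Finset.sum_add_distrib,
    Finset.mul_sum]
  rw [Finset.sum_comm, add_eq_left]
  refine Finset.sum_eq_zero fun j _ => ?_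
  rw [← mul_zero (t j), ← h j, Finset.mul_sum]
  exact Finset.sum_congr rfl fun i _ => by ring

end Projection

/-! ### The two inclusions -/

section Variety

variable {K L : Type*} [Field K] [Field L] [Algebra K L] (ord : AddValuation L (WithTop ℝ))

/-- The vectors of valuations of the zeros of `I` in the torus. -/
def ordZeros {n : ℕ} (I : Ideal (MvPolynomial (Fin n) K)) : Set (Fin n → ℝ) :=
  {w | ∃ z : Fin n → L, (∀ f ∈ I, MvPolynomial.aeval z f = 0) ∧
    ∀ i, ord (z i) = ((w i : ℝ) : WithTop ℝ)}

theorem tropVariety_eq_closure {n : ℕ} (I : Ideal (MvPolynomial (Fin n) K)) :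
    tropVariety ord I = closure (ordZeros ord I) := rfl

variable {ord} {n l k : ℕ}

/-- Translating the valuations of a zero of `I` by a rational multiple of the value of a fixed
element along each of the vectors of `u` gives the valuations of a zero of the elimination ideal. -/
theorem add_mem_ordZeros_elimIdeal (u : Fin l → Fin n → ℚ) {I : Ideal (MvPolynomial (Fin n) K)}
    (χ : Multiplicative ℚ →* Lˣ) {w : Fin n → ℝ} (hw : w ∈ ordZeros ord I) (q : Fin l → ℚ) :
    (fun i => w i + ∑ j, ((q j : ℝ) * realOrd ord (χ (.ofAdd 1) : L)) * (u j i : ℝ)) ∈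
      ordZeros ord (elimIdeal (twistIdeal u I)) := by
  obtain ⟨z, hz, hzw⟩ := hw
  refine ⟨_, fun f hf => aeval_eq_zero_of_mem_elimIdeal
    (fun g hg => evalAt_eq_zero_of_mem_twistIdeal u hz χ (fun j => -q j) hg) hf, fun i => ?_⟩
  obtain ⟨hz0, hzi⟩ := ord_eq_coe_iff.1 (hzw i)
  refine ord_eq_coe_iff.2 ⟨mul_ne_zero hz0 (Units.ne_zero _), ?_⟩
  rw [realOrd_mul hz0 (Units.ne_zero _), hzi, realOrd_rat]
  push_cast
  simp only [neg_mul, Finset.sum_neg_distrib, neg_neg, Finset.sum_mul]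
  congr 1
  exact Finset.sum_congr rfl fun j _ => by ring

/-- Bounded vectors of valuations of zeros of the elimination ideal are translates along the span
of `u` of vectors in a bounded set of valuations of zeros of `I`. -/
theorem exists_mem_ordZeros_of_bounded [IsAlgClosed L] {u : Fin l → Fin n → ℚ}
    {I : Ideal (MvPolynomial (Fin n) K)} (hreg : AlgRegular u I) (M : ℝ) :
    ∃ B : ℝ, ∀ w ∈ ordZeros ord (elimIdeal (twistIdeal u I)), (∀ i, |w i| ≤ M) →
      ∃ s ∈ ordZeros ord I, (∀ i, |s i| ≤ B) ∧
        ∃ t : Fin l → ℝ, s = fun i => w i + ∑ j, t j * (u j i : ℝ) := by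
  obtain ⟨B, hB⟩ := exists_extension_le (L := L) ord hreg M l le_rfl
  set b := ∑ i : Fin n, ∑ j, |B| * |(u j i : ℝ)| with hb
  refine ⟨M + b, fun w hw hwM => ?_⟩
  obtain ⟨x, hx, hxw⟩ := hw
  have hx0 : ∀ i, x i ≠ 0 := fun i => (ord_eq_coe_iff.1 (hxw i)).1
  have hxw' : ∀ i, realOrd ord (x i) = w i := fun i => (ord_eq_coe_iff.1 (hxw i)).2
  obtain ⟨lam, hlam, hzero⟩ := hB x hx0 (fun i => by rw [hxw']; exact hwM i) hx
  set N : ℕ := ∏ j, ∏ i, (u j i).den with hN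
  have hN0 : N ≠ 0 := Finset.prod_ne_zero_iff.2 fun j _ =>
    Finset.prod_ne_zero_iff.2 fun i _ => (u j i).den_ne_zero
  have hU : ∀ j i, ∃ U : ℤ, (U : ℚ) = N * u j i := by
    intro j i
    obtain ⟨c, hc⟩ : (u j i).den ∣ N :=
      (Finset.dvd_prod_of_mem (fun i => (u j i).den) (Finset.mem_univ i)).trans
        (Finset.dvd_prod_of_mem (fun j => ∏ i, (u j i).den) (Finset.mem_univ j))
    refine ⟨c * (u j i).num, ?_⟩
    rw [hc]
    push_cast
    rw [mul_comm ((u j i).den : ℚ), mul_assoc, Rat.den_mul_eq_num]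
  choose U hU using hU
  -- With all l variables allowed, membership in `partialRing` is vacuous.
  obtain ⟨z, hz, hzN⟩ := exists_zero_of_zero_twistIdeal hN0 hU
    (fun g hg => hzero g hg fun p _ j hj => absurd j.2 (not_lt.2 hj))
  have hne : ∀ i, x i ^ N ≠ 0 := fun i => pow_ne_zero _ (hx0 i)
  have hne' : ∀ i, ∏ j, ((lam j ^ U j i : Lˣ) : L) ≠ 0 := fun i =>
    Finset.prod_ne_zero_iff.2 fun j _ => Units.ne_zero _
  have hz0 : ∀ i, z i ≠ 0 := fun i h0 => by
    have := hzN i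
    rw [h0, zero_pow hN0] at this
    exact mul_ne_zero (hne i) (hne' i) this.symm
  have hval : ∀ i, realOrd ord (z i) = w i + ∑ j, realOrd ord (lam j : L) * (u j i : ℝ) := by
    intro i
    have h1 := congrArg (realOrd ord) (hzN i)
    rw [realOrd_pow (hz0 i), realOrd_mul (hne i) (hne' i), realOrd_pow (hx0 i),
      realOrd_prod _ (fun j => Units.ne_zero _), hxw'] at h1
    have hN' : (N : ℝ) ≠ 0 := Nat.cast_ne_zero.2 hN0
    apply mul_left_cancel₀ hN'
    rw [h1, mul_add, Finset.mul_sum]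
    congr 1
    refine Finset.sum_congr rfl fun j _ => ?_
    have : ((U j i : ℤ) : ℝ) = N * (u j i : ℝ) := by
      exact_mod_cast congrArg (Rat.cast (K := ℝ)) (hU j i)
    rw [realOrd_units_zpow, this]
    ring
  refine ⟨fun i => realOrd ord (z i), ⟨z, hz, fun i => ord_eq_realOrd (hz0 i)⟩, fun i => ?_,
    fun j => realOrd ord (lam j : L), funext hval⟩
  simp only [hval]
  refine (abs_add_le _ _).trans (add_le_add (hwM i) ?_)
  refine le_trans ?_ (Finset.single_le_sum (f := fun i : Fin n => ∑ j, |B| * |(u j i : ℝ)|)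
    (fun i _ => by positivity) (Finset.mem_univ i))
  refine (Finset.abs_sum_le_sum_abs _ _).trans (Finset.sum_le_sum fun j _ => ?_)
  rw [abs_mul]
  exact mul_le_mul_of_nonneg_right ((hlam j).trans (le_abs_self B)) (abs_nonneg _)

theorem add_combination_mem_tropVariety [IsAlgClosed L] {a : L} (ha : a ≠ 0) (ha' : ord a ≠ 0)
    (u : Fin l → Fin n → ℚ) {I : Ideal (MvPolynomial (Fin n) K)} {w : Fin n → ℝ}
    (hw : w ∈ tropVariety ord I) (t : Fin l → ℝ) :
    (fun i => w i + ∑ j, t j * (u j i : ℝ)) ∈ tropVariety ord (elimIdeal (twistIdeal u I)) := by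
  obtain ⟨χ, hχ⟩ := IsAlgClosed.exists_rat_monoidHom (Units.mk0 a ha)
  set c := realOrd ord (χ (.ofAdd 1) : L) with hc
  have hc0 : c ≠ 0 := by
    rw [hc, hχ, Units.val_mk0]
    intro h0
    apply ha'
    rw [ord_eq_realOrd ha, h0, WithTop.coe_zero]
  -- Nontriviality of the valuation enters here: c ≠ 0 makes ℚc dense in ℝ.
  have hdense : DenseRange fun (q : Fin l → ℚ) j => (q j : ℝ) * c := by
    have h1 : DenseRange fun q : ℚ => (q : ℝ) * c :=
      (mul_right_surjective₀ hc0).denseRange.comp Rat.denseRange_cast (by fun_prop)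
    exact DenseRange.piMap fun _ => h1
  refine map_mem_closure₂ (f := fun (w : Fin n → ℝ) (t : Fin l → ℝ) (i : Fin n) =>
    w i + ∑ j, t j * (u j i : ℝ)) (by fun_prop) hw (hdense t) ?_
  rintro w hw _ ⟨q, rfl⟩
  exact add_mem_ordZeros_elimIdeal u χ hw q

/-- A linear projection need not map closed sets to closed sets. But all valuation vectors near w
have partners in one fixed box, and the image of the part of T(I) in that box is compact, hence
closed, so it contains the image of w. -/
theorem proj_mem_image_of_mem_tropVariety [IsAlgClosed L] {A : Matrix (Fin k) (Fin n) ℚ}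
    {u : Fin l → Fin n → ℚ} (hu : ∀ j i, A.row i ⬝ᵥ u j = 0)
    {I : Ideal (MvPolynomial (Fin n) K)} (hreg : AlgRegular u I) {w : Fin n → ℝ}
    (hw : w ∈ tropVariety ord (elimIdeal (twistIdeal u I))) :
    proj A w ∈ proj A '' tropVariety ord I := by
  obtain ⟨B, hB⟩ := exists_mem_ordZeros_of_bounded (ord := ord) hreg (‖w‖ + 1)
  have hcpt : IsCompact (proj A '' (tropVariety ord I ∩ Set.Icc (fun _ => -B) fun _ => B)) :=
    (isCompact_Icc.inter_left isClosed_closure).image (continuous_proj A)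
  refine Set.image_mono Set.inter_subset_left (hcpt.isClosed.closure_subset ?_)
  have hw' : w ∈ closure (Metric.ball w 1 ∩ ordZeros ord (elimIdeal (twistIdeal u I))) := by
    rw [tropVariety_eq_closure] at hw
    exact Metric.isOpen_ball.inter_closure ⟨Metric.mem_ball_self one_pos, hw⟩
  refine map_mem_closure (continuous_proj A) hw' ?_
  rintro v ⟨hvw, hv⟩
  obtain ⟨s, hs, hsB, t, hst⟩ := hB v hv fun i => by
    have h1 : ‖v i‖ ≤ ‖v‖ := norm_le_pi_norm v i
    have h2 := norm_le_norm_add_norm_sub' v w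
    rw [Metric.mem_ball, dist_eq_norm] at hvw
    rw [← Real.norm_eq_abs]
    linarith
  refine ⟨s, ⟨subset_closure hs, fun i => (abs_le.1 (hsB i)).1, fun i => (abs_le.1 (hsB i)).2⟩, ?_⟩
  rw [hst]
  exact proj_add_combination hu v t

end Variety

end

end TropProj

theorem theorem3p5
    {K : Type*} [Field K] {L : Type*} [Field L] [Algebra K L] [IsAlgClosure K L]
    -- a non-trivial real valuation on `K`, and its extension to the algebraic closure
    (ordK : AddValuation K (WithTop ℝ)) (hnontriv : ∃ a : K, a ≠ 0 ∧ ordK a ≠ 0)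
    (ord : AddValuation L (WithTop ℝ)) (hext : ∀ a : K, ord (algebraMap K L a) = ordK a)
    {n m l : ℕ} (hl : l + (m + 1) = n)
    (I : Ideal (MvPolynomial (Fin n) K)) (hI : I.IsPrime)
    -- a rational matrix of full rank, and a basis of the orthogonal complement of its row space
    (A : Matrix (Fin (m + 1)) (Fin n) ℚ) (hA : LinearIndependent ℚ A.row)
    (u : Fin l → Fin n → ℚ) (hu : LinearIndependent ℚ u)
    (huA : (Submodule.span ℚ (Set.range u) : Set (Fin n → ℚ)) =
      {x | ∀ i, A.row i ⬝ᵥ x = 0})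
    (hreg : TropProj.AlgRegular u I) :
    TropProj.proj A ⁻¹' (TropProj.proj A '' TropProj.tropVariety ord I) =
      TropProj.tropVariety ord (TropProj.elimIdeal (TropProj.twistIdeal u I)) := by
  have : IsAlgClosed L := IsAlgClosure.isAlgClosed K
  have hu0 : ∀ j i, A.row i ⬝ᵥ u j = 0 := fun j => by
    have : u j ∈ (Submodule.span ℚ (Set.range u) : Set (Fin n → ℚ)) :=
      Submodule.subset_span ⟨j, rfl⟩
    rwa [huA] at this
  obtain ⟨a, ha, ha'⟩ := hnontriv
  ext w
  constructor
  · rintro ⟨w₀, hw₀, hw⟩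
    have hker : TropProj.proj A (w - w₀) = 0 := by rw [TropProj.proj_sub, hw, sub_self]
    obtain ⟨t, ht⟩ := Matrix.exists_real_combination_of_mulVec_eq_zero hA (u := u)
      (fun x hx => by
        rw [← SetLike.mem_coe, huA]
        exact fun i => congrFun hx i) hker
    have := TropProj.add_combination_mem_tropVariety (a := algebraMap K L a)
      ((map_ne_zero _).2 ha) (by rwa [hext]) u hw₀ t
    convert this using 1
    ext i
    rw [← ht i, Pi.sub_apply, add_sub_cancel]
  · exact fun hw => TropProj.proj_mem_image_of_mem_tropVariety hu0 hreg hw
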